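/- All spaces are Tychonoff (completely regular and Hausdorff). A space $X$ is an *$s_{\mathbb R}$-space* if every sequentially continuous function $f:X\to\mathbb R$ is continuous; it is *locally pseudocompact* if every point of $X$ has a neighbourhood which, as a subspace, is pseudocompact (that is, every continuous real-valued function on it is bounded). It is *Fréchet–Urysohn* if, whenever a point $x$ lies in the closure of a set $A\subseteq X$, some sequence of points of $A$ converges to $x$. **Theorem.** For a Tychonoff space $Y$ the following assertions are equivalent: (i) $Y$ is a locally pseudocompact $s_{\mathbb R}$-space; (ii) $X\times Y$ is an $s_{\mathbb R}$-space for every Tychonoff $s_{\mathbb R}$-space $X$; (iii) $X\times Y$ is an $s_{\mathbb R}$-space for every Tychonoff Fréchet–Urysohn space $X$. -/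

import Mathlib

open Topology

universe u v

/-- `X` is an `s_ℝ`-space: every sequentially continuous real-valued function on `X` is
continuous. -/
def IsSRSpace (X : Type*) [TopologicalSpace X] : Prop :=
  ∀ f : X → ℝ, SeqContinuous f → Continuous f

/-- `X` is pseudocompact: every continuous real-valued function on `X` is bounded.
(The Tychonoff axiom is carried separately, as an instance.) -/
def IsPseudocompactSpace (X : Type*) [TopologicalSpace X] : Prop :=
  ∀ f : X → ℝ, Continuous f → Bornology.IsBounded (Set.range f)

/-- `X` is locally pseudocompact: every point has a neighbourhood (not necessarily open or closed)
which, with the subspace topology, is a pseudocompact space. -/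
def IsLocallyPseudocompactSpace (X : Type*) [TopologicalSpace X] : Prop :=
  ∀ x : X, ∃ U ∈ 𝓝 x, IsPseudocompactSpace U

open Filter Set Bornology
open scoped BoundedContinuousFunction

/-! Sufficiency is an exponential-law argument: for sequentially continuous `f` on `X × Y` and a
pseudocompact neighbourhood `U` in `Y`, the map `c ↦ f (c, ·)` from `X` to bounded functions on `U`
is sequentially continuous for the sup metric, hence continuous. Convergence along a sequence in `X`
is locally uniform because `Y` is an `s_ℝ`-space (`SeqContinuous.tendstoLocallyUniformly`), and
uniform on `U` by pseudocompactness. For necessity, if `y` has no pseudocompact neighbourhood, a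
Fréchet–Urysohn fan with one spine per subset of `Y` carries locally finite bumps near `y`; gluing
them gives a sequentially continuous function that is discontinuous at `(vertex, y)`. -/

/-! ### Sufficiency: uniform convergence and products -/

theorem SeqContinuous.tendsto_atTop_prod {X Y Z : Type*} [TopologicalSpace X] [TopologicalSpace Y]
    [TopologicalSpace Z] {f : X × Y → Z} (hf : SeqContinuous f) {x : ℕ → X} {a : X} {y : ℕ → Y}
    {b : Y} (hx : Tendsto x atTop (𝓝 a)) (hy : Tendsto y atTop (𝓝 b)) :
    Tendsto (fun p : ℕ × ℕ => f (x p.1, y p.2)) atTop (𝓝 (f (a, b))) := by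
  refine tendsto_of_seq_tendsto fun u hu => ?_
  rw [← prod_atTop_atTop_eq] at hu
  exact hf ((hx.comp (tendsto_fst.comp hu)).prodMk_nhds (hy.comp (tendsto_snd.comp hu)))

theorem SeqContinuous.comp_continuous {X Y Z : Type*} [TopologicalSpace X] [TopologicalSpace Y]
    [TopologicalSpace Z] {g : Y → Z} {f : X → Y} (hg : SeqContinuous g) (hf : Continuous f) :
    SeqContinuous (g ∘ f) :=
  fun _ _ h => hg ((hf.tendsto _).comp h)

theorem IsSRSpace.continuous_of_seqContinuous {X M : Type*} [TopologicalSpace X]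
    [PseudoMetricSpace M] (hX : IsSRSpace X) {f : X → M} (hf : SeqContinuous f) :
    Continuous f := by
  refine continuous_iff_continuousAt.2 fun a => ?_
  have hc : Continuous fun x => dist (f x) (f a) :=
    hX _ fun u p hu => (hf hu).dist tendsto_const_nhds
  rw [ContinuousAt, tendsto_iff_dist_tendsto_zero]
  simpa using hc.tendsto a

/-- On a pseudocompact space, a locally uniformly convergent sequence of continuous functions
converges uniformly. -/
theorem IsPseudocompactSpace.tendstoUniformly {X M : Type*} [TopologicalSpace X]
    [PseudoMetricSpace M] (hX : IsPseudocompactSpace X) {F : ℕ → X → M} {f : X → M}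
    (hF : ∀ n, Continuous (F n)) (h : TendstoLocallyUniformly F f atTop) :
    TendstoUniformly F f atTop := by
  have hf : Continuous f := h.continuous (Frequently.of_forall hF)
  rw [Metric.tendstoLocallyUniformly_iff] at h
  rw [Metric.tendstoUniformly_iff]
  intro ε hε
  -- The weight `n` makes the locally finite sum unbounded if the error reaches `ε` for infinitely
  -- many `n`.
  let b : ℕ → X → ℝ := fun n x => n * max 0 (dist (f x) (F n x) - ε / 2)
  have hb0 : ∀ n x, 0 ≤ b n x := fun n x => by positivity
  have hlf : LocallyFinite fun n => Function.support (b n) := by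
    intro x
    obtain ⟨t, ht, hn⟩ := h (ε / 2) (half_pos hε) x
    obtain ⟨N, hN⟩ := eventually_atTop.1 hn
    refine ⟨t, ht, (finite_lt_nat N).subset ?_⟩
    rintro n ⟨z, hz, hzt⟩
    by_contra hnN
    refine hz ?_
    have := hN n (not_lt.1 hnN) z hzt
    simp only [b]
    rw [max_eq_left (by linarith), mul_zero]
  have hcont : Continuous fun x => ∑ᶠ n, b n x :=
    continuous_finsum (fun n => by have := hF n; fun_prop) hlf
  obtain ⟨C, hC⟩ := (hX _ hcont).exists_norm_le
  obtain ⟨N, hN⟩ := exists_nat_gt (C / (ε / 2))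
  filter_upwards [eventually_ge_atTop (N + 1)] with n hn x
  by_contra! hx
  have h1 : b n x ≤ ∑ᶠ m, b m x :=
    single_le_finsum n (hlf.point_finite x) fun m => hb0 m x
  have h2 : ∑ᶠ m, b m x ≤ C := (le_abs_self _).trans (hC _ ⟨x, rfl⟩)
  have h3 : (n : ℝ) * (ε / 2) ≤ b n x := by
    refine mul_le_mul_of_nonneg_left (le_max_of_le_right ?_) n.cast_nonneg
    linarith
  have h4 : (N : ℝ) + 1 ≤ n := by exact_mod_cast hn
  rw [div_lt_iff₀ (half_pos hε)] at hN
  nlinarith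

/-- The map sending `y` to the bounded sequence `n ↦ f (x n, y)` is sequentially continuous in the
sup metric: joint convergence controls large `n`, and finitely many sections remain. Its continuity
is equicontinuity of the sections, which upgrades pointwise convergence. -/
theorem SeqContinuous.tendstoLocallyUniformly {X Y : Type*} [TopologicalSpace X]
    [TopologicalSpace Y] (hY : IsSRSpace Y) {f : X × Y → ℝ} (hf : SeqContinuous f) {x : ℕ → X}
    {a : X} (hx : Tendsto x atTop (𝓝 a)) :
    TendstoLocallyUniformly (fun n y => f (x n, y)) (fun y => f (a, y)) atTop := by
  have hpt : ∀ y, Tendsto (fun n => f (x n, y)) atTop (𝓝 (f (a, y))) := fun y =>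
    hf (hx.prodMk_nhds tendsto_const_nhds)
  have hsec : ∀ c, SeqContinuous fun y => f (c, y) := fun c =>
    hf.comp_continuous (Continuous.prodMk_right c)
  have hbd : ∀ y, ∃ C, ∀ n, ‖f (x n, y)‖ ≤ C := fun y => by
    obtain ⟨C, hC⟩ := (Metric.isBounded_range_of_tendsto _ (hpt y)).exists_norm_le
    exact ⟨C, fun n => hC _ ⟨n, rfl⟩⟩
  choose C hC using hbd
  let h : Y → (ℕ →ᵇ ℝ) := fun y =>
    BoundedContinuousFunction.ofNormedAddCommGroupDiscrete (fun n => f (x n, y)) (C y) (hC y)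
  have hh : SeqContinuous h := by
    intro y b hy
    rw [Metric.tendsto_nhds]
    intro ε hε
    have h1 := Metric.tendsto_nhds.1 (hf.tendsto_atTop_prod hx hy) (ε / 4) (by positivity)
    have h2 := Metric.tendsto_nhds.1 (hpt b) (ε / 4) (by positivity)
    rw [← prod_atTop_atTop_eq, eventually_prod_iff] at h1
    obtain ⟨p, hp, q, hq, hpq⟩ := h1
    obtain ⟨N, hN⟩ := eventually_atTop.1 (hp.and h2)
    have h3 : ∀ᶠ k in atTop, ∀ n ∈ Finset.range N,
        dist (f (x n, y k)) (f (x n, b)) < ε / 2 := by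
      rw [eventually_all_finset]
      exact fun n _ => Metric.tendsto_nhds.1 (hsec (x n) hy) _ (half_pos hε)
    filter_upwards [hq, h3] with k hk hk3
    refine lt_of_le_of_lt ((BoundedContinuousFunction.dist_le (half_pos hε).le).2 fun n => ?_)
      (half_lt_self hε)
    change dist (f (x n, y k)) (f (x n, b)) ≤ ε / 2
    rcases lt_or_ge n N with hn | hn
    · exact (hk3 n (Finset.mem_range.2 hn)).le
    · have e1 : dist (f (x n, y k)) (f (a, b)) < ε / 4 := hpq (hN n hn).1 hk
      have e2 := (hN n hn).2
      have := dist_triangle_right (f (x n, y k)) (f (x n, b)) (f (a, b))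
      linarith
  have hhc := hY.continuous_of_seqContinuous hh
  have hac := hY _ (hsec a)
  rw [Metric.tendstoLocallyUniformly_iff]
  intro ε hε y
  have e3 : 0 < ε / 3 := by positivity
  refine ⟨_, (Metric.tendsto_nhds.1 (hhc.tendsto y) _ e3).and
    (Metric.tendsto_nhds.1 (hac.tendsto y) _ e3), ?_⟩
  filter_upwards [Metric.tendsto_nhds.1 (hpt y) _ e3] with n hn z hz
  obtain ⟨hz1, hz2⟩ := hz
  have h1 : dist (f (x n, z)) (f (x n, y)) < ε / 3 :=
    (BoundedContinuousFunction.dist_coe_le_dist (f := h z) (g := h y) n).trans_lt hz1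
  have t1 := dist_triangle (f (a, z)) (f (a, y)) (f (x n, z))
  have t2 := dist_triangle (f (a, y)) (f (x n, y)) (f (x n, z))
  rw [dist_comm] at h1 hn
  linarith

theorem IsSRSpace.prod {X Y : Type*} [TopologicalSpace X] [TopologicalSpace Y]
    (hX : IsSRSpace X) (hY : IsSRSpace Y) (hlp : IsLocallyPseudocompactSpace Y) :
    IsSRSpace (X × Y) := by
  intro f hf
  have hsec : ∀ c, Continuous fun y => f (c, y) := fun c =>
    hY _ (hf.comp_continuous (Continuous.prodMk_right c))
  refine continuous_iff_continuousAt.2 fun ⟨a, b⟩ => ?_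
  obtain ⟨U, hU, hUp⟩ := hlp b
  have hres : ∀ c, Continuous fun u : U => f (c, u) := fun c =>
    (hsec c).comp continuous_subtype_val
  have hbd : ∀ c, ∃ C, ∀ u : U, ‖f (c, u)‖ ≤ C := fun c => by
    obtain ⟨C, hC⟩ := (hUp _ (hres c)).exists_norm_le
    exact ⟨C, fun u => hC _ ⟨u, rfl⟩⟩
  choose C hC using hbd
  let G : X → (U →ᵇ ℝ) := fun c =>
    BoundedContinuousFunction.ofNormedAddCommGroup (fun u : U => f (c, u)) (hres c) (C c) (hC c)
  have hG : SeqContinuous G := fun x c hx =>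
    BoundedContinuousFunction.tendsto_iff_tendstoUniformly.2 <|
      hUp.tendstoUniformly (fun n => hres (x n))
        ((hf.tendstoLocallyUniformly hY hx).comp Subtype.val continuous_subtype_val)
  have hGc := hX.continuous_of_seqContinuous hG
  have hon : ContinuousOn f {p : X × Y | p.2 ∈ U} := by
    rw [continuousOn_iff_continuous_domRestrict]
    have : Continuous fun p : {p : X × Y | p.2 ∈ U} => G p.1.1 ⟨p.1.2, p.2⟩ := by fun_prop
    exact this
  exact hon.continuousAt (continuous_snd.continuousAt hU)

/-! ### The sequential fan -/

theorem FrechetUrysohnSpace.isSRSpace (X : Type*) [TopologicalSpace X] [FrechetUrysohnSpace X] :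
    IsSRSpace X :=
  fun _ hf => hf.continuous

/-- The sequential fan with `κ` spines: a vertex and, for each `k : κ`, a sequence of isolated
points tending to it. A neighbourhood of the vertex contains cofinitely many points of each
spine. -/
inductive SequentialFan (κ : Type*)
  | vertex
  | spine (p : κ × ℕ)

namespace SequentialFan

variable {κ : Type*}

instance : TopologicalSpace (SequentialFan κ) where
  IsOpen s := vertex ∈ s → ∀ k, ∀ᶠ n in atTop, spine (k, n) ∈ s
  isOpen_univ := fun _ _ => Eventually.of_forall fun _ => trivial
  isOpen_inter := fun _ _ hs ht h k => (hs h.1 k).and (ht h.2 k)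
  isOpen_sUnion := fun _ hS ⟨t, ht, h⟩ k => (hS t ht h k).mono fun _ hn => ⟨t, ht, hn⟩

theorem isOpen_iff {s : Set (SequentialFan κ)} :
    IsOpen s ↔ (vertex ∈ s → ∀ k, ∀ᶠ n in atTop, spine (k, n) ∈ s) :=
  Iff.rfl

theorem isClopen_of_isOpen_of_vertex_mem {s : Set (SequentialFan κ)} (hs : IsOpen s)
    (h : vertex ∈ s) : IsClopen s :=
  ⟨⟨isOpen_iff.2 fun h' => absurd h h'⟩, hs⟩

theorem isClopen_singleton_spine (p : κ × ℕ) : IsClopen ({spine p} : Set (SequentialFan κ)) := by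
  refine ⟨⟨isOpen_iff.2 fun _ k => ?_⟩, isOpen_iff.2 fun h => by cases h⟩
  filter_upwards [eventually_gt_atTop p.2] with n hn h
  have : (k, n) = p := spine.inj h
  exact hn.ne' (congrArg Prod.snd this)

instance : T35Space (SequentialFan κ) where
  t0 := by
    intro a b hab
    by_contra hne
    cases a with
    | spine p => exact hne ((hab.mem_open_iff (isClopen_singleton_spine p).2).1 rfl).symm
    | vertex =>
      cases b with
      | vertex => exact hne rfl
      | spine p => exact hne ((hab.mem_open_iff (isClopen_singleton_spine p).2).2 rfl)
  completely_regular := by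
    refine fun x K hK hx => ?_
    obtain ⟨s, hs, hxs, hsK⟩ : ∃ s : Set (SequentialFan κ), IsClopen s ∧ x ∈ s ∧ s ⊆ Kᶜ := by
      cases x with
      | vertex => exact ⟨Kᶜ, isClopen_of_isOpen_of_vertex_mem hK.isOpen_compl hx, hx, subset_rfl⟩
      | spine p => exact ⟨_, isClopen_singleton_spine p, rfl, singleton_subset_iff.2 hx⟩
    classical
    refine ⟨sᶜ.indicator 1, ?_, indicator_of_notMem (not_not.2 hxs) _,
      fun y hy => indicator_of_mem (s := sᶜ) (fun h => hsK h hy) _⟩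
    exact continuous_one.indicator fun y hy => by
      rw [hs.compl.frontier_eq] at hy; exact hy.elim

instance : FrechetUrysohnSpace (SequentialFan κ) where
  closure_subset_seqClosure := by
    intro s x hx
    by_cases hxs : x ∈ s
    · exact subset_seqClosure hxs
    cases x with
    | spine p =>
      obtain ⟨y, hy, hys⟩ := mem_closure_iff.1 hx _ (isClopen_singleton_spine p).2 rfl
      exact absurd (hy ▸ hys) hxs
    | vertex =>
      have : ∃ k, ∃ᶠ n in atTop, spine (k, n) ∈ s := by
        by_contra! h
        have ho : IsOpen sᶜ := isOpen_iff.2 fun _ k => h k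
        obtain ⟨y, hy, hys⟩ := mem_closure_iff.1 hx _ ho hxs
        exact hy hys
      obtain ⟨k, hk⟩ := this
      obtain ⟨φ, hφ, hs⟩ := extraction_of_frequently_atTop hk
      refine ⟨fun n => spine (k, φ n), hs, ?_⟩
      rw [tendsto_nhds]
      exact fun t ht h => hφ.tendsto_atTop.eventually (isOpen_iff.1 ht h k)

variable {Y : Type*}

/-- The function on `SequentialFan κ × Y` given by `φ k n` on the slice over the `n`-th point of
the spine `k` and by `0` on the slice over the vertex. -/
def glue (φ : κ → ℕ → Y → ℝ) : SequentialFan κ × Y → ℝ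
  | (vertex, _) => 0
  | (spine p, y) => φ p.1 p.2 y

theorem seqContinuous_glue [TopologicalSpace Y] {φ : κ → ℕ → Y → ℝ}
    (hc : ∀ k n, Continuous (φ k n))
    (hlf : ∀ k, LocallyFinite fun n => Function.support (φ k n)) :
    SeqContinuous (glue φ) := by
  rintro u ⟨x, y⟩ hu
  have hx : Tendsto (fun j => (u j).1) atTop (𝓝 x) := (continuous_fst.tendsto _).comp hu
  have hy : Tendsto (fun j => (u j).2) atTop (𝓝 y) := (continuous_snd.tendsto _).comp hu
  cases x with
  | spine p =>
    have hp : ∀ᶠ j in atTop, (u j).1 = spine p :=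
      hx.eventually ((isClopen_singleton_spine p).2.mem_nhds rfl)
    refine Tendsto.congr' ?_ (((hc p.1 p.2).tendsto y).comp hy)
    filter_upwards [hp] with j hj
    change _ = glue φ ((u j).1, (u j).2)
    rw [hj]
    rfl
  | vertex =>
    -- On each spine `D` is finite: local finiteness at `y` handles the tail of `u`, and each of the
    -- first `J` terms contributes at most one point. So `u` eventually avoids `D`.
    let D : Set (SequentialFan κ) := {z | ∃ j, (u j).1 = z ∧ glue φ (u j) ≠ 0}
    have hD : IsOpen Dᶜ := by
      refine isOpen_iff.2 fun _ k => ?_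
      obtain ⟨V, hV, hfin⟩ := hlf k y
      obtain ⟨J, hJ⟩ := eventually_atTop.1 (hy.eventually hV)
      have hlast : ∀ᶠ n in atTop, n ∉ {n | (Function.support (φ k n) ∩ V).Nonempty} := by
        rw [← Nat.cofinite_eq_atTop]
        exact hfin.eventually_cofinite_notMem
      have hinit : ∀ᶠ n in atTop, ∀ j ∈ Finset.range J, (u j).1 ≠ spine (k, n) := by
        rw [eventually_all_finset]
        intro j _
        rcases hj : (u j).1 with _ | p
        · exact Eventually.of_forall fun n h => by cases h
        · filter_upwards [eventually_gt_atTop p.2] with n hn h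
          have : p = (k, n) := spine.inj h
          exact hn.ne (congrArg Prod.snd this)
      filter_upwards [hlast, hinit] with n hn1 hn2
      rintro ⟨j, hj, hne⟩
      rcases lt_or_ge j J with hjJ | hjJ
      · exact hn2 j (Finset.mem_range.2 hjJ) hj
      · refine hn1 ⟨(u j).2, ?_, hJ j hjJ⟩
        change glue φ ((u j).1, (u j).2) ≠ 0 at hne
        rwa [hj] at hne
    have hvertex : (vertex : SequentialFan κ) ∈ Dᶜ := by
      rintro ⟨j, hj, hne⟩
      change glue φ ((u j).1, (u j).2) ≠ 0 at hne
      rw [hj] at hne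
      exact hne rfl
    refine tendsto_const_nhds.congr' ?_
    filter_upwards [hx.eventually (hD.mem_nhds hvertex)] with j hj
    by_contra h
    exact hj ⟨j, rfl, fun h0 => h h0.symm⟩

end SequentialFan

/-! ### Necessity of local pseudocompactness -/

theorem exists_continuousOn_not_isBounded_image {Y : Type*} [TopologicalSpace Y] {K : Set Y}
    (hK : ¬ IsPseudocompactSpace K) :
    ∃ h : Y → ℝ, ContinuousOn h K ∧ ¬ IsBounded (h '' K) := by
  simp only [IsPseudocompactSpace, not_forall] at hK
  obtain ⟨g, hg, hb⟩ := hK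
  have hext : K.domRestrict (Function.extend Subtype.val g 0) = g :=
    funext fun u => Subtype.val_injective.extend_apply g 0 u
  refine ⟨Function.extend Subtype.val g 0, ?_, ?_⟩
  · rw [continuousOn_iff_continuous_domRestrict, hext]
    exact hg
  · rwa [← range_domRestrict, hext]

/-- If no neighbourhood of `y` is pseudocompact, then every neighbourhood of `y` meets the members
of a locally finite sequence of bump functions. -/
theorem exists_locallyFinite_bump {Y : Type*} [TopologicalSpace Y] [CompletelyRegularSpace Y]
    {y : Y} (hy : ∀ U ∈ 𝓝 y, ¬ IsPseudocompactSpace U) {O : Set Y} (hO : O ∈ 𝓝 y) :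
    ∃ φ : ℕ → Y → ℝ, (∀ n, Continuous (φ n)) ∧
      (LocallyFinite fun n => Function.support (φ n)) ∧ ∀ n, ∃ w ∈ O, φ n w = 1 := by
  -- `h` will be continuous on `closure W`, giving local finiteness even at boundary points, yet
  -- unbounded on the open set `W`, where the bumps live.
  set W := interior O
  have hK : closure W ∈ 𝓝 y := mem_of_superset (interior_mem_nhds.2 hO) subset_closure
  obtain ⟨h, hc, hb⟩ := exists_continuousOn_not_isBounded_image (hy _ hK)
  have hbW : ¬ IsBounded (h '' W) := fun hbd => hb (hbd.closure.subset hc.image_closure)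
  have hw : ∀ n : ℕ, ∃ w ∈ W, (n : ℝ) < |h w| := by
    intro n
    by_contra! hle
    exact hbW (isBounded_iff_forall_norm_le.2 ⟨n, by rintro _ ⟨w, hw, rfl⟩; exact hle w hw⟩)
  choose w hwW hwn using hw
  let V : ℕ → Set Y := fun n => W ∩ h ⁻¹' {t | (n : ℝ) < |t|}
  have hV : ∀ n, IsOpen (V n) := fun n =>
    (hc.mono subset_closure).isOpen_inter_preimage isOpen_interior
      (isOpen_lt continuous_const continuous_abs)
  have hlf : LocallyFinite V := by
    intro z
    by_cases hz : z ∈ closure W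
    · have hn : ∀ᶠ t in 𝓝 z, t ∈ closure W → |h t| < |h z| + 1 :=
        eventually_nhdsWithin_iff.1 ((hc z hz).abs.eventually (gt_mem_nhds (lt_add_one _)))
      obtain ⟨N, hN⟩ := exists_nat_gt (|h z| + 1)
      refine ⟨_, hn, (finite_lt_nat N).subset ?_⟩
      rintro n ⟨t, ⟨htW, htn⟩, ht⟩
      have h1 := ht (subset_closure htW)
      have h2 : (n : ℝ) < |h t| := htn
      exact_mod_cast h2.trans (h1.trans hN)
    · refine ⟨_, isClosed_closure.isOpen_compl.mem_nhds hz, ?_⟩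
      convert finite_empty
      refine eq_empty_of_forall_notMem ?_
      rintro n ⟨t, ⟨htW, -⟩, ht⟩
      exact ht (subset_closure htW)
  have hφ : ∀ n, ∃ φ : Y → ℝ, Continuous φ ∧ φ (w n) = 1 ∧ Function.support φ ⊆ V n := by
    intro n
    obtain ⟨g, hg, h0, h1⟩ :=
      CompletelyRegularSpace.completely_regular_isOpen (w n) (V n) (hV n) ⟨hwW n, hwn n⟩
    refine ⟨fun z => 1 - g z, by fun_prop, by simp [h0], fun z hz => ?_⟩
    by_contra hzV
    exact hz (by simp [h1 hzV])
  choose φ hφc hφ1 hφV using hφ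
  exact ⟨φ, hφc, hlf.subset hφV, fun n => ⟨w n, interior_subset (hwW n), hφ1 n⟩⟩

/-- Diagonalisation: the spine `e O` carries bumps reaching `1` inside `O`, so every box `s × O`
around `(vertex, y)` contains a point where the glued function is `1`, although it vanishes over the
vertex. -/
theorem IsSRSpace.isLocallyPseudocompactSpace_of_sequentialFan {Y κ : Type*} [TopologicalSpace Y]
    [CompletelyRegularSpace Y] (e : Set Y → κ) (he : Function.Injective e)
    (h : IsSRSpace (SequentialFan κ × Y)) : IsLocallyPseudocompactSpace Y := by
  intro y
  by_contra! hy
  have hex : ∀ k : κ, ∃ φ : ℕ → Y → ℝ, (∀ n, Continuous (φ n)) ∧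
      (LocallyFinite fun n => Function.support (φ n)) ∧
      ∀ O ∈ 𝓝 y, e O = k → ∀ n, ∃ w ∈ O, φ n w = 1 := by
    intro k
    by_cases hk : ∃ O ∈ 𝓝 y, e O = k
    · obtain ⟨O, hO, rfl⟩ := hk
      obtain ⟨φ, h1, h2, h3⟩ := exists_locallyFinite_bump hy hO
      exact ⟨φ, h1, h2, fun O' _ hO' => he hO' ▸ h3⟩
    · exact ⟨fun _ _ => 0, fun _ => continuous_const,
        fun _ => ⟨univ, univ_mem, by simp⟩,
        fun O hO hOk => absurd ⟨O, hO, hOk⟩ hk⟩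
  choose φ hc hlf h1 using hex
  have hcont := h _ (SequentialFan.seqContinuous_glue hc hlf)
  have hlt : ∀ᶠ p in 𝓝 ((SequentialFan.vertex : SequentialFan κ), y), SequentialFan.glue φ p < 1 :=
    hcont.continuousAt.eventually (gt_mem_nhds zero_lt_one)
  rw [nhds_prod_eq, eventually_prod_iff] at hlt
  obtain ⟨p, hp, q, hq, hpq⟩ := hlt
  obtain ⟨s, hsp, hs, hns⟩ := mem_nhds_iff.1 hp
  obtain ⟨n, hn⟩ := (SequentialFan.isOpen_iff.1 hs hns (e {z | q z})).exists
  obtain ⟨w, hw, hw1⟩ := h1 _ _ hq rfl n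
  exact (hpq (hsp hn) hw).ne hw1

theorem IsSRSpace.of_prod_right {X Y : Type*} [TopologicalSpace X] [TopologicalSpace Y] [Nonempty X]
    (h : IsSRSpace (X × Y)) : IsSRSpace Y := by
  intro f hf
  have := h (f ∘ Prod.snd) (hf.comp_continuous continuous_snd)
  exact this.comp (Continuous.prodMk_right (Classical.arbitrary X))

/-- Tychonoff spaces are Mathlib's `T35Space`. The spaces `X` range over a universe at least as
large as that of `Y`. -/
theorem theorem4p11 (Y : Type u) [TopologicalSpace Y] [T35Space Y] :
    List.TFAE [
      IsLocallyPseudocompactSpace Y ∧ IsSRSpace Y,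
      ∀ (X : Type (max u v)) [TopologicalSpace X] [T35Space X],
        IsSRSpace X → IsSRSpace (X × Y),
      ∀ (X : Type (max u v)) [TopologicalSpace X] [T35Space X] [FrechetUrysohnSpace X],
        IsSRSpace (X × Y)] := by
  tfae_have 1 → 2 := fun h X _ _ hX => hX.prod h.2 h.1
  tfae_have 2 → 3 := fun h X _ _ _ => h X (FrechetUrysohnSpace.isSRSpace X)
  tfae_have 3 → 1 := by
    intro h
    -- `ULift` places the fan in the universe of the test spaces.
    have hfan := h (SequentialFan (ULift.{v} (Set Y)))
    have : Nonempty (SequentialFan (ULift.{v} (Set Y))) := ⟨.vertex⟩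
    exact ⟨hfan.isLocallyPseudocompactSpace_of_sequentialFan ULift.up ULift.up_injective,
      hfan.of_prod_right⟩
  tfae_finish
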